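/- A bi-infinite sequence $x\in\{1,3\}^{\mathbb Z}$ is \emph{differentiable} if it is constant on no half-line and all its maximal mono-symbol blocks have length $1$ or $3$; its derivative $\Delta x\in\{1,3\}^{\mathbb Z}$ is then the sequence of the lengths of its consecutive blocks, $(\Delta x)_0$ being the length of the block containing position $0$. It is \emph{smooth} if $\Delta^k x$ is differentiable for all $k\ge 0$, and a smooth $x$ is \emph{infinitely well-aligned} if, for every $k\ge 0$, the block of $\Delta^k x$ containing position $0$ starts at position $0$, that is, $(\Delta^k x)_{-1}\neq(\Delta^k x)_0$. The column sequence of $x$ is $\Phi(x)=\bigl((\Delta^k x)_0\bigr)_{k\ge 0}$, and $\overline{\Phi(x)}$ is obtained from it by exchanging $1$s and $3$s. Recode a smooth sequence $x$ block by block with $A=1$, $B=3$, $C=111$, $D=333$. The sequence $x$ has type $0$ if its recoding contains a factor $ABA$ or $DCD$, and type $1$ if its recoding contains a factor $BAB$ or $CDC$. The type sequence of $x$ is $(\mathrm{type}(\Delta^n x))_{n\ge 0}\in\{0,1\}^{\mathbb N}$. For a finite word $w$ over $\{1,3\}$, $\mathrm{freq}_x(w)=\lim_{n\to\infty}\frac1n|x_0\cdots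 x_{n-1}|_w$, where $|u|_w$ is the number of occurrences of $w$ in $u$. \textbf{Proposition.} Let $x$ be an infinitely well-aligned smooth sequence. Then there is exactly one infinitely well-aligned smooth sequence $\tilde x$ with $\Phi(\tilde x)=\overline{\Phi(x)}$, and $\tilde x\ne x$. The sequences $x$ and $\tilde x$ each have a unique, well-defined type sequence, and these two type sequences are equal. Moreover, for every finite word $w$ over $\{1,3\}$, the frequencies $\mathrm{freq}_x(w)$ and $\mathrm{freq}_{\tilde x}(w)$ exist and are equal. -/

import Mathlib

open Filter Topology

namespace SmoothSeq

/-- A bi-infinite sequence all of whose terms are `1` or `3`. Bi-infinite sequences are functions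
`ℤ → ℕ`, so that sequences and their run-length encodings live in the same type. -/
def OneThree (x : ℤ → ℕ) : Prop := ∀ n, x n = 1 ∨ x n = 3

/-- A mono-symbol block of `x` starts at `n`. -/
def IsBlockStart (x : ℤ → ℕ) (n : ℤ) : Prop := x (n - 1) ≠ x n

/-- `x` is eventually constant neither to the right nor to the left, i.e. it is a bi-infinite
concatenation of finite mono-symbol blocks. -/
def NonStationary (x : ℤ → ℕ) : Prop :=
  (∀ n, ∃ m, n < m ∧ IsBlockStart x m) ∧ (∀ n, ∃ m, m < n ∧ IsBlockStart x m)

/-- The start of the block containing the position `0`. -/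
noncomputable def originStart (x : ℤ → ℕ) : ℤ := sSup {m | m ≤ 0 ∧ IsBlockStart x m}

/-- The first block start to the right of `n`. -/
noncomputable def nextStart (x : ℤ → ℕ) (n : ℤ) : ℤ := sInf {m | n < m ∧ IsBlockStart x m}

/-- The last block start to the left of `n`. -/
noncomputable def prevStart (x : ℤ → ℕ) (n : ℤ) : ℤ := sSup {m | m < n ∧ IsBlockStart x m}

/-- The starting position of the `j`-th block of a non-stationary sequence `x`, the blocks being
numbered from left to right in such a way that block `0` is the one containing the position `0`. -/
noncomputable def blockStart (x : ℤ → ℕ) : ℤ → ℤ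
  | Int.ofNat j => (nextStart x)^[j] (originStart x)
  | Int.negSucc j => (prevStart x)^[j + 1] (originStart x)

/-- The derivative of a non-stationary sequence: the sequence of the lengths of its consecutive
mono-symbol blocks, the term of index `0` being the length of the block containing `x 0`. -/
noncomputable def deriv (x : ℤ → ℕ) : ℤ → ℕ :=
  fun j => (blockStart x (j + 1) - blockStart x j).toNat

/-- The iterated derivative `Δ^k x`. -/
noncomputable def iterDeriv (k : ℕ) (x : ℤ → ℕ) : ℤ → ℕ := deriv^[k] x

/-- Differentiability of a sequence over `{1, 3}`: its derivative is well defined and is again a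
sequence over `{1, 3}`. -/
def IsDifferentiable (x : ℤ → ℕ) : Prop := OneThree x ∧ NonStationary x ∧ OneThree (deriv x)

/-- The set `X` of bi-infinite smooth (infinitely differentiable) sequences over `{1, 3}`. -/
def smoothSet : Set (ℤ → ℕ) := {x | ∀ k, IsDifferentiable (iterDeriv k x)}

/-- The block containing the position `0` starts at `0`. -/
def WellAligned (x : ℤ → ℕ) : Prop := IsBlockStart x 0

/-- The set `B_X^L` of the smooth sequences `x` such that `x, Δ x, …, Δ^(L-1) x` are
well-aligned. -/
def alignedSet (L : ℕ) : Set (ℤ → ℕ) :=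
  {x | x ∈ smoothSet ∧ ∀ k, k < L → WellAligned (iterDeriv k x)}

/-- The set of infinitely well-aligned smooth sequences. -/
def infAlignedSet : Set (ℤ → ℕ) := ⋂ L : ℕ, ⋂ _ : 1 ≤ L, alignedSet L

/-- The column sequence `Φ(x)`. -/
noncomputable def column (x : ℤ → ℕ) : ℕ → ℕ := fun k => iterDeriv k x 0

/-- The sequence deduced from `u` by exchanging the symbols `1` and `3`. -/
def swapOneThree (u : ℕ → ℕ) : ℕ → ℕ := fun k => Equiv.swap 1 3 (u k)

/-- The number of occurrences of the finite word `w` in the prefix `x 0 ⋯ x (n - 1)`. -/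
def occ (x : ℤ → ℕ) (w : List ℕ) (n : ℕ) : ℕ :=
  ((Finset.range n).filter
    (fun i => i + w.length ≤ n ∧ ∀ k : Fin w.length, x ((i : ℤ) + (k : ℤ)) = w.get k)).card

/-- The frequency of the word `w` in `x` exists and is equal to `f`. -/
def HasFreq (x : ℤ → ℕ) (w : List ℕ) (f : ℝ) : Prop :=
  Tendsto (fun n : ℕ => (occ x w n : ℝ) / (n : ℝ)) atTop (𝓝 f)

/-- The letters encoding the mono-symbol blocks: `A = 1`, `B = 3`, `C = 111`, `D = 333`. -/
inductive Letter
  | A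
  | B
  | C
  | D

/-- The recoding of a differentiable sequence: the `j`-th letter encodes the `j`-th block. -/
noncomputable def recoding (x : ℤ → ℕ) : ℤ → Letter := fun j =>
  if deriv x j = 1 then
    if x (blockStart x j) = 1 then Letter.A else Letter.B
  else
    if x (blockStart x j) = 1 then Letter.C else Letter.D

/-- The three-letter word `a b c` is a factor of `y`. -/
def HasFactor (y : ℤ → Letter) (a b c : Letter) : Prop :=
  ∃ j, y j = a ∧ y (j + 1) = b ∧ y (j + 2) = c

/-- The sequence `x` has type `t`. For a smooth `x` the three-letter elementary blocks of its
recoding are exactly the factors `ABA`, `BAB`, `CDC`, `DCD`. -/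
def HasType (x : ℤ → ℕ) (t : Fin 2) : Prop :=
  (t = 0 ∧ (HasFactor (recoding x) Letter.A Letter.B Letter.A ∨
    HasFactor (recoding x) Letter.D Letter.C Letter.D)) ∨
  (t = 1 ∧ (HasFactor (recoding x) Letter.B Letter.A Letter.B ∨
    HasFactor (recoding x) Letter.C Letter.D Letter.C))

/-- `τ` is a sequence of types of the iterated derivatives of `x`. -/
def HasTypes (x : ℤ → ℕ) (τ : ℕ → Fin 2) : Prop := ∀ n, HasType (iterDeriv n x) (τ n)

end SmoothSeq

/-! The second sequence is the reflection `n ↦ x (-1 - n)`. Alignment makes the cut between `-1` and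
`0` a block boundary at every level, so reflection commutes with derivation, and the entry at `-1`
is always the other symbol: the column gets swapped. Uniqueness is injectivity of the column map:
the column gives the first two letters of every derivative, their expansions are arbitrarily long
prefixes of `x`, and reflection handles the left half.

Block lengths are odd, so the `j`-th block starts at a position of the parity of `j`. Hence the type
at each level is decided by whether two consecutive column entries agree, which the swap does not
affect (`hasType_iff`).

For frequencies, cut every derivative into pairs at even positions. With `s` the first symbol, only
`33`, `s (flip s)` and `11` occur. By parity, expanding one level turns each pair into a
concatenation of pairs, always including the mixed one with a share of at least `1/5`. So the
occurrence ratios of the three expansions contract to one limit (`PairSystem.exists_limit`).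
Reflection reverses words, so equality of the two frequencies needs a further argument: swapping the
column turns the expansion `u ++ v` of the mixed pair into `v ++ u` (`exists_pairExp_swap`), which
changes the count by at most `|w|`. -/

namespace SmoothSeq

/-! ### Enumerations of block starts -/

/-- `g` enumerates the block starts of `x` from left to right, `g 0` being the start of the block
containing the position `0`. -/
structure IsEnum (x : ℤ → ℕ) (g : ℤ → ℤ) : Prop where
  start : ∀ j, IsBlockStart x (g j)
  lt : ∀ j, g j < g (j + 1)
  gap : ∀ j n, g j < n → n < g (j + 1) → ¬ IsBlockStart x n
  zero_le : g 0 ≤ 0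
  one_pos : 0 < g 1

theorem IsEnum.nextStart_eq {x : ℤ → ℕ} {g : ℤ → ℤ} (h : IsEnum x g) (j : ℤ) :
    nextStart x (g j) = g (j + 1) := by
  refine IsLeast.csInf_eq ⟨⟨h.lt j, h.start _⟩, ?_⟩
  rintro m ⟨hm, hs⟩
  by_contra hlt
  exact h.gap j m hm (not_le.1 hlt) hs

theorem IsEnum.prevStart_eq {x : ℤ → ℕ} {g : ℤ → ℤ} (h : IsEnum x g) (j : ℤ) :
    prevStart x (g (j + 1)) = g j := by
  refine IsGreatest.csSup_eq ⟨⟨h.lt j, h.start _⟩, ?_⟩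
  rintro m ⟨hm, hs⟩
  by_contra hlt
  exact h.gap j m (not_le.1 hlt) hm hs

theorem IsEnum.originStart_eq {x : ℤ → ℕ} {g : ℤ → ℤ} (h : IsEnum x g) :
    originStart x = g 0 := by
  refine IsGreatest.csSup_eq ⟨⟨h.zero_le, h.start _⟩, ?_⟩
  rintro m ⟨hm, hs⟩
  by_contra hlt
  exact h.gap 0 m (not_le.1 hlt) (by have := h.one_pos; simp only [zero_add]; omega) hs

/-- Uniqueness of the enumeration: a derivative can be computed from any explicit enumeration, as is
done for reflections. -/
theorem IsEnum.blockStart_eq {x : ℤ → ℕ} {g : ℤ → ℤ} (h : IsEnum x g) : blockStart x = g := by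
  have hnext : ∀ j : ℕ, (nextStart x)^[j] (originStart x) = g j := by
    intro j
    induction j with
    | zero => simp [h.originStart_eq]
    | succ j ih =>
      rw [Function.iterate_succ_apply', ih, h.nextStart_eq]
      push_cast; rfl
  have hprev : ∀ j : ℕ, (prevStart x)^[j] (originStart x) = g (-j) := by
    intro j
    induction j with
    | zero => simp [h.originStart_eq]
    | succ j ih =>
      rw [Function.iterate_succ_apply', ih]
      have := h.prevStart_eq (-((j + 1 : ℕ) : ℤ))
      rw [← this]
      congr 2
      push_cast; ring
  funext j
  cases j with
  | ofNat j => exact hnext j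
  | negSucc j => exact hprev (j + 1)

theorem NonStationary.isLeast_nextStart {x : ℤ → ℕ} (h : NonStationary x) (n : ℤ) :
    IsLeast {m | n < m ∧ IsBlockStart x m} (nextStart x n) := by
  have hb : BddBelow {m | n < m ∧ IsBlockStart x m} := ⟨n, fun m hm => hm.1.le⟩
  exact ⟨Int.csInf_mem (h.1 n) hb, fun m hm => csInf_le hb hm⟩

theorem NonStationary.isGreatest_prevStart {x : ℤ → ℕ} (h : NonStationary x) (n : ℤ) :
    IsGreatest {m | m < n ∧ IsBlockStart x m} (prevStart x n) := by
  have hb : BddAbove {m | m < n ∧ IsBlockStart x m} := ⟨n, fun m hm => hm.1.le⟩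
  exact ⟨Int.csSup_mem (h.2 n) hb, fun m hm => le_csSup hb hm⟩

theorem NonStationary.isGreatest_originStart {x : ℤ → ℕ} (h : NonStationary x) :
    IsGreatest {m | m ≤ 0 ∧ IsBlockStart x m} (originStart x) := by
  have hb : BddAbove {m : ℤ | m ≤ 0 ∧ IsBlockStart x m} := ⟨0, fun m hm => hm.1⟩
  obtain ⟨m, hm, hs⟩ := h.2 0
  exact ⟨Int.csSup_mem ⟨m, hm.le, hs⟩ hb, fun m hm => le_csSup hb hm⟩

theorem NonStationary.isBlockStart_blockStart {x : ℤ → ℕ} (h : NonStationary x) (j : ℤ) :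
    IsBlockStart x (blockStart x j) := by
  cases j with
  | ofNat j =>
    cases j with
    | zero => exact h.isGreatest_originStart.1.2
    | succ j =>
      change IsBlockStart x ((nextStart x)^[j + 1] (originStart x))
      rw [Function.iterate_succ_apply']
      exact (h.isLeast_nextStart _).1.2
  | negSucc j =>
    change IsBlockStart x ((prevStart x)^[j + 1] (originStart x))
    rw [Function.iterate_succ_apply']
    exact (h.isGreatest_prevStart _).1.2

theorem NonStationary.nextStart_prevStart {x : ℤ → ℕ} (h : NonStationary x) {n : ℤ}
    (hn : IsBlockStart x n) : nextStart x (prevStart x n) = n := by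
  refine IsLeast.csInf_eq ⟨⟨(h.isGreatest_prevStart n).1.1, hn⟩, ?_⟩
  rintro m ⟨hm, hs⟩
  by_contra hlt
  exact absurd ((h.isGreatest_prevStart n).2 ⟨not_le.1 hlt, hs⟩) (not_le.2 hm)

theorem NonStationary.blockStart_succ {x : ℤ → ℕ} (h : NonStationary x) (j : ℤ) :
    blockStart x (j + 1) = nextStart x (blockStart x j) := by
  cases j with
  | ofNat j =>
    change (nextStart x)^[j + 1] (originStart x) = nextStart x ((nextStart x)^[j] (originStart x))
    rw [Function.iterate_succ_apply']
  | negSucc j =>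
    have key : blockStart x (Int.negSucc j + 1) = (prevStart x)^[j] (originStart x) := by
      cases j with
      | zero => rfl
      | succ j => rfl
    have hs := h.isBlockStart_blockStart (Int.negSucc j + 1)
    rw [key] at hs ⊢
    change _ = nextStart x ((prevStart x)^[j + 1] (originStart x))
    rw [Function.iterate_succ_apply', h.nextStart_prevStart hs]

theorem NonStationary.isEnum {x : ℤ → ℕ} (h : NonStationary x) : IsEnum x (blockStart x) where
  start := h.isBlockStart_blockStart
  lt j := by
    rw [h.blockStart_succ]
    exact (h.isLeast_nextStart _).1.1
  gap j n h1 h2 hs := by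
    rw [h.blockStart_succ] at h2
    exact absurd ((h.isLeast_nextStart _).2 ⟨h1, hs⟩) (not_le.2 h2)
  zero_le := h.isGreatest_originStart.1.1
  one_pos := by
    have h1 : blockStart x 1 = nextStart x (originStart x) := rfl
    rw [h1]
    by_contra hle
    have hl := (h.isLeast_nextStart (originStart x)).1
    exact absurd (h.isGreatest_originStart.2 ⟨not_lt.1 hle, hl.2⟩) (not_le.2 hl.1)

theorem IsEnum.strictMono {x : ℤ → ℕ} {g : ℤ → ℤ} (h : IsEnum x g) : StrictMono g :=
  strictMono_int_of_lt_succ h.lt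

theorem IsEnum.exists_le_lt {x : ℤ → ℕ} {g : ℤ → ℤ} (h : IsEnum x g) (n : ℤ) :
    ∃ j, g j ≤ n ∧ n < g (j + 1) := by
  have hup : ∀ k : ℕ, (k : ℤ) < g (k + 1) := by
    intro k
    induction k with
    | zero => simpa using h.one_pos
    | succ k ih => have := h.lt (k + 1); push_cast; omega
  have hdn : ∀ k : ℕ, g (-k) ≤ -k := by
    intro k
    induction k with
    | zero => simpa using h.zero_le
    | succ k ih =>
      have := h.lt (-(k + 1))
      rw [show (-((k : ℤ) + 1) + 1) = -k by ring] at this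
      push_cast at ih ⊢; omega
  obtain ⟨j, hj, hmax⟩ := Int.exists_greatest_of_bdd (P := fun j => g j ≤ n)
    ⟨n.natAbs + 1, fun z hz => by
      by_contra hlt
      have := h.strictMono (not_le.1 hlt)
      have := hup n.natAbs
      omega⟩
    ⟨-n.natAbs, (hdn n.natAbs).trans (by omega)⟩
  refine ⟨j, hj, ?_⟩
  by_contra hlt
  have := hmax (j + 1) (not_lt.1 hlt)
  omega

theorem IsEnum.exists_eq {x : ℤ → ℕ} {g : ℤ → ℤ} (h : IsEnum x g) {n : ℤ}
    (hn : IsBlockStart x n) : ∃ j, n = g j := by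
  obtain ⟨j, h1, h2⟩ := h.exists_le_lt n
  refine ⟨j, ?_⟩
  by_contra hne
  exact h.gap j n (lt_of_le_of_ne h1 (Ne.symm hne)) h2 hn

theorem IsEnum.eq_of_mem {x : ℤ → ℕ} {g : ℤ → ℤ} (h : IsEnum x g) {j : ℤ} (k : ℕ)
    (hk : g j + k < g (j + 1)) : x (g j + k) = x (g j) := by
  induction k with
  | zero => simp
  | succ k ih =>
    have h1 := h.gap j (g j + (k + 1 : ℕ)) (by push_cast; omega) hk
    rw [← ih (by push_cast at hk; omega)]
    unfold IsBlockStart at h1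
    push Not at h1
    rw [← h1]
    congr 1
    push_cast; ring

/-! ### Aligned sequences: alternating symbols and parity -/

/-- The symbol exchange `1 ↔ 3`. -/
def flip (s : ℕ) : ℕ := Equiv.swap 1 3 s

@[simp] theorem flip_one : flip 1 = 3 := rfl
@[simp] theorem flip_three : flip 3 = 1 := rfl
@[simp] theorem flip_flip (s : ℕ) : flip (flip s) = s := by
  simp [flip]

/-- The symbol at index `j` of the alternating sequence taking the value `s` at `0`. -/
def alt (s : ℕ) (j : ℤ) : ℕ := if Even j then s else flip s

theorem alt_succ (s : ℕ) (j : ℤ) : alt s (j + 1) = flip (alt s j) := by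
  unfold alt
  by_cases h : Even j
  · simp [h]
  · simp [h]

theorem eq_flip_of_ne {a b : ℕ} (ha : a = 1 ∨ a = 3) (hb : b = 1 ∨ b = 3) (h : a ≠ b) :
    b = flip a := by
  rcases ha with rfl | rfl <;> rcases hb with rfl | rfl <;> simp_all

theorem flip_mem {a : ℕ} (ha : a = 1 ∨ a = 3) : flip a = 1 ∨ flip a = 3 := by
  rcases ha with rfl | rfl <;> simp

theorem flip_ne {a : ℕ} (ha : a = 1 ∨ a = 3) : flip a ≠ a := by
  rcases ha with rfl | rfl <;> simp

/-- A differentiable sequence whose block at the origin starts there. -/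
structure Nice (x : ℤ → ℕ) : Prop where
  diff : IsDifferentiable x
  aligned : WellAligned x

namespace Nice

variable {x : ℤ → ℕ} (h : Nice x)
include h

theorem isEnum : IsEnum x (blockStart x) := h.diff.2.1.isEnum

theorem oneThree (n : ℤ) : x n = 1 ∨ x n = 3 := h.diff.1 n

theorem deriv_oneThree (n : ℤ) : deriv x n = 1 ∨ deriv x n = 3 := h.diff.2.2 n

theorem blockStart_zero : blockStart x 0 = 0 := by
  obtain ⟨j, hj⟩ := h.isEnum.exists_eq h.aligned
  have h1 : j < 1 := h.isEnum.strictMono.lt_iff_lt.1 (hj ▸ h.isEnum.one_pos)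
  have h2 : 0 ≤ j := h.isEnum.strictMono.le_iff_le.1 (hj ▸ h.isEnum.zero_le)
  obtain rfl : j = 0 := by omega
  exact hj.symm

theorem blockStart_succ (j : ℤ) : blockStart x (j + 1) = blockStart x j + deriv x j := by
  have := h.isEnum.lt j
  unfold deriv
  omega

theorem apply_blockStart (j : ℤ) : x (blockStart x j) = alt (x 0) j := by
  have step : ∀ j, x (blockStart x (j + 1)) = flip (x (blockStart x j)) := by
    intro j
    have h1 : x (blockStart x (j + 1) - 1) = x (blockStart x j) := by
      have hlt := h.isEnum.lt j
      have := h.isEnum.eq_of_mem (j := j) (blockStart x (j + 1) - 1 - blockStart x j).toNat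
        (by omega)
      rw [← this]; congr 1; omega
    rw [← h1]
    exact eq_flip_of_ne (h.oneThree _) (h.oneThree _) (h.isEnum.start (j + 1))
  induction j using Int.induction_on with
  | zero => simp [h.blockStart_zero, alt]
  | succ j ih => rw [step, ih, alt_succ]
  | pred j ih =>
    have h1 := step (-j - 1)
    have h2 := alt_succ (x 0) (-j - 1)
    rw [show (-(j : ℤ) - 1 + 1) = -j by ring] at h1 h2
    rw [ih, h2] at h1
    have := congrArg flip h1
    simpa using this.symm

theorem apply_eq_alt {j n : ℤ} (h1 : blockStart x j ≤ n) (h2 : n < blockStart x (j + 1)) :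
    x n = alt (x 0) j := by
  rw [← h.apply_blockStart j, ← h.isEnum.eq_of_mem (j := j) (n - blockStart x j).toNat (by omega)]
  congr 1; omega

/-- All blocks have odd length and block `0` starts at `0`, so each step flips both parities. -/
theorem even_blockStart_iff (j : ℤ) : Even (blockStart x j) ↔ Even j := by
  have step : ∀ j, Even (blockStart x (j + 1)) ↔ ¬ Even (blockStart x j) := by
    intro j
    rw [h.blockStart_succ]
    rcases h.deriv_oneThree j with h1 | h1 <;> rw [h1] <;> simp only [Int.even_iff] <;>
      push_cast <;> omega
  induction j using Int.induction_on with
  | zero => simp [h.blockStart_zero]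
  | succ j ih => rw [step, not_congr ih, Int.even_add_one]
  | pred j ih =>
    have h1 := step (-j - 1)
    rw [show (-(j : ℤ) - 1 + 1) = -j by ring] at h1
    have h2 := ih.symm.trans h1
    rw [Int.even_sub_one]
    tauto

theorem alt_blockStart (s : ℕ) (j : ℤ) : alt s (blockStart x j) = alt s j := by
  simp only [alt, h.even_blockStart_iff]

end Nice

/-! ### Reflection and the swapped column -/

/-- The reflection exchanging the positions `0` and `-1`. -/
def mirror (x : ℤ → ℕ) : ℤ → ℕ := fun n => x (-1 - n)

theorem isBlockStart_mirror {x : ℤ → ℕ} {n : ℤ} :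
    IsBlockStart (mirror x) n ↔ IsBlockStart x (-n) := by
  unfold IsBlockStart mirror
  rw [show -1 - (n - 1) = -n by ring, show -1 - n = -n - 1 by ring]
  exact ne_comm

theorem Nice.isEnum_mirror {x : ℤ → ℕ} (h : Nice x) :
    IsEnum (mirror x) (fun j => -blockStart x (-j)) where
  start j := by rw [isBlockStart_mirror, neg_neg]; exact h.isEnum.start _
  lt j := by
    have := h.isEnum.lt (-(j + 1))
    rw [show -(j + 1) + 1 = -j by ring] at this
    simpa using this
  gap j n h1 h2 hs := by
    rw [isBlockStart_mirror] at hs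
    refine h.isEnum.gap (-(j + 1)) (-n) (by omega) ?_ hs
    rw [show -(j + 1) + 1 = -j by ring]
    omega
  zero_le := by simp [h.blockStart_zero]
  one_pos := by
    have := h.isEnum.lt (-1)
    simp only [Int.reduceNeg, neg_add_cancel, h.blockStart_zero] at this
    simpa using this

/-- Reflection negates the block boundaries, so block `j` of the mirror image is block `-1 - j` of
`x`. -/
theorem Nice.deriv_mirror {x : ℤ → ℕ} (h : Nice x) : deriv (mirror x) = mirror (deriv x) := by
  funext j
  unfold mirror deriv
  have := h.isEnum_mirror.blockStart_eq
  unfold mirror at this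
  rw [this]
  congr 1
  simp only
  rw [show -1 - j + 1 = -j by ring, show -(j + 1) = -1 - j by ring]
  ring

theorem Nice.mirror {x : ℤ → ℕ} (h : Nice x) : Nice (mirror x) where
  diff := by
    refine ⟨fun n => h.oneThree _, ⟨fun n => ?_, fun n => ?_⟩, ?_⟩
    · obtain ⟨m, hm, hs⟩ := h.diff.2.1.2 (-n)
      exact ⟨-m, by omega, by rw [isBlockStart_mirror, neg_neg]; exact hs⟩
    · obtain ⟨m, hm, hs⟩ := h.diff.2.1.1 (-n)
      exact ⟨-m, by omega, by rw [isBlockStart_mirror, neg_neg]; exact hs⟩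
    · rw [h.deriv_mirror]
      exact fun n => h.deriv_oneThree _
  aligned := by
    have := h.aligned
    unfold WellAligned at *
    rw [isBlockStart_mirror]
    simpa using this

theorem mem_infAlignedSet_iff {x : ℤ → ℕ} : x ∈ infAlignedSet ↔ ∀ k, Nice (iterDeriv k x) := by
  simp only [infAlignedSet, alignedSet, Set.mem_iInter, Set.mem_ofPred_eq]
  constructor
  · intro h k
    obtain ⟨h1, h2⟩ := h (k + 1) (by omega)
    exact ⟨h1 k, h2 k (by omega)⟩
  · intro h L _
    exact ⟨fun k => (h k).diff, fun k _ => (h k).aligned⟩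

theorem iterDeriv_succ (k : ℕ) (x : ℤ → ℕ) : iterDeriv (k + 1) x = deriv (iterDeriv k x) :=
  Function.iterate_succ_apply' deriv k x

theorem iterDeriv_mirror {x : ℤ → ℕ} (hx : x ∈ infAlignedSet) (k : ℕ) :
    iterDeriv k (mirror x) = mirror (iterDeriv k x) := by
  rw [mem_infAlignedSet_iff] at hx
  induction k with
  | zero => rfl
  | succ k ih => rw [iterDeriv_succ, iterDeriv_succ, ih, (hx k).deriv_mirror]

theorem mirror_mem_infAlignedSet {x : ℤ → ℕ} (hx : x ∈ infAlignedSet) :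
    mirror x ∈ infAlignedSet := by
  rw [mem_infAlignedSet_iff]
  intro k
  rw [iterDeriv_mirror hx]
  exact (mem_infAlignedSet_iff.1 hx k).mirror

theorem column_oneThree {x : ℤ → ℕ} (hx : x ∈ infAlignedSet) (k : ℕ) :
    column x k = 1 ∨ column x k = 3 :=
  (mem_infAlignedSet_iff.1 hx k).oneThree 0

/-- At every level position `-1` lies in the block preceding the one at `0`, hence carries the other
symbol. -/
theorem column_mirror {x : ℤ → ℕ} (hx : x ∈ infAlignedSet) :
    column (mirror x) = swapOneThree (column x) := by
  funext k
  have h := mem_infAlignedSet_iff.1 hx k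
  have h1 : IsBlockStart (iterDeriv k x) 0 := h.aligned
  unfold column
  rw [iterDeriv_mirror hx]
  exact eq_flip_of_ne (h.oneThree _) (h.oneThree _) h1.symm

/-! ### Types -/

/-- In a derivative of an aligned sequence, a run of three equal symbols is a block. -/
theorem Nice.exists_blockStart_of_run {x : ℤ → ℕ} (h : Nice x) {j : ℤ} (h1 : x j = x (j + 1))
    (h2 : x (j + 1) = x (j + 2)) : ∃ i, j = blockStart x i := by
  obtain ⟨i, hi, hi'⟩ := h.isEnum.exists_le_lt j
  refine ⟨i, ?_⟩
  by_contra hne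
  have hs := h.isEnum.start (i + 1)
  unfold IsBlockStart at hs
  have hsucc := h.blockStart_succ i
  -- Here `j` is the second or third position of a block of length `3`, so the next boundary falls
  -- inside the run.
  have : blockStart x (i + 1) = j + 1 ∨ blockStart x (i + 1) = j + 2 := by
    rcases h.deriv_oneThree i with h3 | h3 <;> rw [h3] at hsucc <;> push_cast at hsucc <;> omega
  rcases this with h3 | h3 <;> rw [h3] at hs
  · exact hs (by simpa using h1)
  · exact hs (by rw [show j + 2 - 1 = j + 1 by ring]; exact h2)

theorem NonStationary.exists_eq_three {x : ℤ → ℕ} (h : NonStationary x) (ho : OneThree x) :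
    ∃ i, x i = 3 := by
  obtain ⟨m, -, hm⟩ := h.1 0
  unfold IsBlockStart at hm
  rcases ho m with h1 | h1
  · exact ⟨m - 1, (ho (m - 1)).resolve_left fun h2 => hm (h2.trans h1.symm)⟩
  · exact ⟨m, h1⟩

theorem alt_eq_alt_iff {a b : ℕ} (j : ℤ) : alt a j = alt b j ↔ a = b := by
  unfold alt
  split_ifs
  · rfl
  · exact (Equiv.swap 1 3).injective.eq_iff

/-- The type of an aligned sequence can be read off at the origin. -/
theorem hasType_iff {x : ℤ → ℕ} (h0 : Nice x) (h1 : Nice (deriv x))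
    (h2 : Nice (deriv (deriv x))) (t : Fin 2) :
    HasType x t ↔ t = if x 0 = deriv x 0 then 0 else 1 := by
  -- The run starts at block `i` of `deriv x`, and `j` has the parity of `i`. Thus the symbol of `x`
  -- and the entry of `deriv x` at `j` have alternated equally often since the origin.
  have key : ∀ j, deriv x j = deriv x (j + 1) → deriv x (j + 1) = deriv x (j + 2) →
      (x 0 = deriv x 0 ↔ x (blockStart x j) = deriv x j) := by
    intro j e1 e2
    obtain ⟨i, hi⟩ := h1.exists_blockStart_of_run e1 e2
    have a1 := h0.apply_blockStart j
    have a2 := h1.apply_blockStart i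
    rw [← hi] at a2
    rw [a1, a2, ← alt_eq_alt_iff i, ← h1.alt_blockStart (x 0) i, hi]
  have hrec : ∀ j, (recoding x j = Letter.A → deriv x j = 1 ∧ x (blockStart x j) = 1) ∧
      (recoding x j = Letter.B → deriv x j = 1 ∧ x (blockStart x j) = 3) ∧
      (recoding x j = Letter.C → deriv x j = 3 ∧ x (blockStart x j) = 1) ∧
      (recoding x j = Letter.D → deriv x j = 3 ∧ x (blockStart x j) = 3) := by
    intro j
    unfold recoding
    rcases h0.deriv_oneThree j with e | e <;> rcases h0.oneThree (blockStart x j) with e' | e' <;>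
      simp [e, e']
  constructor
  · rintro (⟨rfl, ⟨j, p1, p2, p3⟩ | ⟨j, p1, p2, p3⟩⟩ | ⟨rfl, ⟨j, p1, p2, p3⟩ | ⟨j, p1, p2, p3⟩⟩)
    · have q1 := (hrec j).1 p1
      have q2 := (hrec (j + 1)).2.1 p2
      have q3 := (hrec (j + 2)).1 p3
      rw [if_pos ((key j (by omega) (by omega)).2 (by omega))]
    · have q1 := (hrec j).2.2.2 p1
      have q2 := (hrec (j + 1)).2.2.1 p2
      have q3 := (hrec (j + 2)).2.2.2 p3
      rw [if_pos ((key j (by omega) (by omega)).2 (by omega))]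
    · have q1 := (hrec j).2.1 p1
      have q2 := (hrec (j + 1)).1 p2
      have q3 := (hrec (j + 2)).2.1 p3
      rw [if_neg (fun hh => by have := (key j (by omega) (by omega)).1 hh; omega)]
    · have q1 := (hrec j).2.2.1 p1
      have q2 := (hrec (j + 1)).2.2.2 p2
      have q3 := (hrec (j + 2)).2.2.1 p3
      rw [if_neg (fun hh => by have := (key j (by omega) (by omega)).1 hh; omega)]
  · rintro rfl
    -- A `3` in the second derivative supplies a run of three equal entries in the first, hence an
    -- elementary factor.
    obtain ⟨i, hi⟩ := h2.diff.2.1.exists_eq_three h2.diff.1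
    have hlen := h1.blockStart_succ i
    rw [hi] at hlen
    set j := blockStart (deriv x) i with hj
    have e1 : deriv x (j + 1) = deriv x j := h1.isEnum.eq_of_mem 1 (by push_cast; omega)
    have e2 : deriv x (j + 2) = deriv x j := h1.isEnum.eq_of_mem 2 (by push_cast; omega)
    clear_value j
    have f1 : x (blockStart x (j + 1)) = flip (x (blockStart x j)) := by
      rw [h0.apply_blockStart, h0.apply_blockStart, alt_succ]
    have f2 : x (blockStart x (j + 2)) = x (blockStart x j) := by
      rw [show j + 2 = j + 1 + 1 by ring, h0.apply_blockStart, h0.apply_blockStart, alt_succ,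
        alt_succ, flip_flip]
    have hk := key j e1.symm (e1.trans e2.symm)
    simp only [hk, HasType, HasFactor]
    rcases h0.deriv_oneThree j with e | e <;>
      rcases h0.oneThree (blockStart x j) with e' | e' <;> rw [e, e']
    · exact Or.inl ⟨rfl, Or.inl ⟨j, by simp [recoding, e, e', e1, e2, f1, f2]⟩⟩
    · exact Or.inr ⟨rfl, Or.inl ⟨j, by simp [recoding, e, e', e1, e2, f1, f2]⟩⟩
    · exact Or.inr ⟨rfl, Or.inr ⟨j, by simp [recoding, e, e', e1, e2, f1, f2]⟩⟩
    · exact Or.inl ⟨rfl, Or.inr ⟨j, by simp [recoding, e, e', e1, e2, f1, f2]⟩⟩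

theorem hasTypes_iff {x : ℤ → ℕ} (hx : x ∈ infAlignedSet) (σ : ℕ → Fin 2) :
    HasTypes x σ ↔ σ = fun n => if column x n = column x (n + 1) then 0 else 1 := by
  rw [mem_infAlignedSet_iff] at hx
  have h : ∀ n, HasType (iterDeriv n x) (σ n) ↔
      σ n = if column x n = column x (n + 1) then 0 else 1 := by
    intro n
    have h1 := hx (n + 1)
    have h2 := hx (n + 2)
    rw [iterDeriv_succ] at h1 h2
    rw [iterDeriv_succ] at h2
    rw [hasType_iff (hx n) h1 h2, column, column, iterDeriv_succ]
  rw [funext_iff]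
  exact forall_congr' h

/-! ### Occurrences in finite words -/

/-- The number of positions of the list `l` at which the word `w` occurs. -/
def occList (w : List ℕ) : List ℕ → ℕ
  | [] => 0
  | a :: l => (if w <+: a :: l then 1 else 0) + occList w l

theorem occList_add_le_append (w u v : List ℕ) :
    occList w u + occList w v ≤ occList w (u ++ v) := by
  induction u with
  | nil => simp [occList]
  | cons a u ih =>
    simp only [List.cons_append, occList]
    have : w <+: a :: u → w <+: a :: (u ++ v) := fun h => h.trans (List.prefix_append (a :: u) v)
    split_ifs <;> first | omega | tauto

/-- Only starting positions among the last `w.length` of `u` can give an occurrence not contained in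
`u`. The `min` makes the induction on `u` go through. -/
theorem occList_append_le_min (w u v : List ℕ) :
    occList w (u ++ v) ≤ occList w u + occList w v + min u.length w.length := by
  induction u with
  | nil => simp [occList]
  | cons a u ih =>
    simp only [List.cons_append, occList, List.length_cons]
    by_cases h : w.length ≤ u.length + 1
    · have : w <+: a :: (u ++ v) → w <+: a :: u := fun h' =>
        List.prefix_of_prefix_length_le h' (List.prefix_append (a :: u) v) (by simpa using h)
      split_ifs <;> first | omega | tauto
    · split_ifs <;> omega

theorem occList_append_le (w u v : List ℕ) :
    occList w (u ++ v) ≤ occList w u + occList w v + w.length :=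
  (occList_append_le_min w u v).trans (by omega)

theorem occList_append_comm_le (w u v : List ℕ) :
    occList w (u ++ v) ≤ occList w (v ++ u) + w.length := by
  have := occList_append_le w u v
  have := occList_add_le_append w v u
  omega

/-- The word `x 0 ⋯ x (n - 1)`. -/
def pre (x : ℤ → ℕ) (n : ℕ) : List ℕ := (List.range n).map fun i : ℕ => x (i : ℤ)

@[simp] theorem length_pre (x : ℤ → ℕ) (n : ℕ) : (pre x n).length = n := by simp [pre]

theorem pre_succ (x : ℤ → ℕ) (n : ℕ) : pre x (n + 1) = pre x n ++ [x n] := by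
  simp [pre, List.range_succ]

theorem pre_succ' (x : ℤ → ℕ) (n : ℕ) : pre x (n + 1) = x 0 :: pre (fun i => x (i + 1)) n := by
  simp [pre, List.range_succ_eq_map]

theorem pre_prefix {x : ℤ → ℕ} {m n : ℕ} (h : m ≤ n) : pre x m <+: pre x n := by
  induction n, h using Nat.le_induction with
  | base => exact List.prefix_rfl
  | succ n _ ih => exact ih.trans (by rw [pre_succ]; exact List.prefix_append _ _)

theorem pre_add_of_const {x : ℤ → ℕ} {n k s : ℕ} (h : ∀ i < k, x ((n + i : ℕ) : ℤ) = s) :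
    pre x (n + k) = pre x n ++ List.replicate k s := by
  induction k with
  | zero => simp
  | succ k ih =>
    rw [← add_assoc, pre_succ, ih fun i hi => h i (by omega), h k (by omega),
      List.replicate_succ', List.append_assoc]

theorem prefix_pre_iff (x : ℤ → ℕ) (w : List ℕ) (n : ℕ) :
    w <+: pre x n ↔ w.length ≤ n ∧ ∀ k : Fin w.length, x (k : ℤ) = w.get k := by
  rw [List.prefix_iff_eq_take]
  constructor
  · intro h
    have hl : w.length ≤ n := by
      have := congrArg List.length h
      simp at this; omega
    refine ⟨hl, fun k => ?_⟩
    have hk : (k : ℕ) < ((pre x n).take w.length).length := by simp; omega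
    have : w[(k : ℕ)] = ((pre x n).take w.length)[(k : ℕ)] := by congr 1
    simp only [List.get_eq_getElem, this]
    simp [pre]
  · rintro ⟨hl, h⟩
    refine List.ext_getElem (by simp [hl]) fun i h1 h2 => ?_
    have := h ⟨i, h1⟩
    simp only [List.get_eq_getElem] at this
    simp [← this, pre]

theorem occ_eq_occList (x : ℤ → ℕ) (w : List ℕ) (n : ℕ) : occ x w n = occList w (pre x n) := by
  induction n generalizing x with
  | zero => simp [occ, occList, pre]
  | succ n ih =>
    rw [pre_succ', occList, ← pre_succ', ← ih]
    unfold occ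
    rw [Finset.card_filter, Finset.card_filter, Finset.sum_range_succ', add_comm]
    congr 1
    · congr 1
      rw [prefix_pre_iff]
      simp
    · refine Finset.sum_congr rfl fun i _ => ?_
      congr 1
      have : ∀ k : Fin w.length, ((i : ℤ) + k + 1) = ((i + 1 : ℕ) : ℤ) + k := fun k => by
        push_cast; ring
      simp only [this, eq_iff_iff]
      refine and_congr ?_ Iff.rfl
      omega

/-! ### Expansion, the inverse of derivation -/

/-- The word whose successive blocks have the lengths listed in `l`, with symbols alternating
between `s` and `flip s` and starting with `s`. -/
def expand : ℕ → List ℕ → List ℕ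
  | _, [] => []
  | s, v :: l => List.replicate v s ++ expand (flip s) l

theorem expand_append (s : ℕ) (l m : List ℕ) :
    expand s (l ++ m) = expand s l ++ expand (alt s l.length) m := by
  induction l generalizing s with
  | nil => simp [expand, alt]
  | cons v l ih =>
    have : alt (flip s) l.length = alt s ((v :: l).length : ℕ) := by
      simp only [List.length_cons]
      push_cast
      rw [alt_succ]
      unfold alt
      split_ifs <;> simp
    simp [expand, ih, this]

/-- The length clause is carried along in the induction because it locates the next block. -/
theorem Nice.pre_eq_expand {x : ℤ → ℕ} (h : Nice x) (m : ℕ) :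
    pre x (expand (x 0) (pre (deriv x) m)).length = expand (x 0) (pre (deriv x) m) ∧
      ((expand (x 0) (pre (deriv x) m)).length : ℤ) = blockStart x m := by
  induction m with
  | zero => simp [pre, expand, h.blockStart_zero]
  | succ m ih =>
    have hlen := h.blockStart_succ m
    rw [pre_succ, expand_append, List.length_append]
    have hd : (expand (alt (x 0) (pre (deriv x) m).length) [deriv x m]) =
        List.replicate (deriv x m) (alt (x 0) m) := by simp [expand]
    rw [hd, List.length_replicate]
    refine ⟨?_, by push_cast; rw [hlen, ih.2]⟩
    rw [pre_add_of_const (s := alt (x 0) m), ih.1]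
    intro i hi
    refine h.apply_eq_alt ?_ ?_
    · push_cast; rw [ih.2]; omega
    · push_cast; rw [ih.2, hlen]; omega

/-- Expansion through the levels `n - 1, …, 0` with starting symbols `c (n - 1), …, c 0`. -/
def expandN (c : ℕ → ℕ) : ℕ → List ℕ → List ℕ
  | 0, l => l
  | n + 1, l => expandN c n (expand (c n) l)

theorem pre_eq_expandN {x : ℤ → ℕ} (hx : x ∈ infAlignedSet) (n m : ℕ) :
    pre x (expandN (column x) n (pre (iterDeriv n x) m)).length =
      expandN (column x) n (pre (iterDeriv n x) m) := by
  induction n generalizing m with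
  | zero => simp [expandN, iterDeriv]
  | succ n ih =>
    have h := ((mem_infAlignedSet_iff.1 hx n).pre_eq_expand m).1
    rw [iterDeriv_succ, expandN, column, ← h]
    exact ih _

/-- All entries of `l` are odd. -/
def AllOdd (l : List ℕ) : Prop := ∀ v ∈ l, Odd v

theorem AllOdd.even_length_expand {l : List ℕ} (h : AllOdd l) (s : ℕ) :
    Even (expand s l).length ↔ Even l.length := by
  induction l generalizing s with
  | nil => simp [expand]
  | cons v l ih =>
    have hv : Odd v := h v (by simp)
    have hl : AllOdd l := fun u hu => h u (by simp [hu])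
    rw [← Nat.not_even_iff_odd] at hv
    simp [expand, Nat.even_add, ih hl, Nat.even_add_one, hv]

theorem allOdd_expand {s : ℕ} (hs : s = 1 ∨ s = 3) (l : List ℕ) : AllOdd (expand s l) := by
  induction l generalizing s with
  | nil => simp [AllOdd, expand]
  | cons v l ih =>
    intro u hu
    simp only [expand, List.mem_append, List.mem_replicate] at hu
    rcases hu with ⟨-, rfl⟩ | hu
    · rcases hs with rfl | rfl <;> decide
    · exact ih (flip_mem hs) u hu

/-- The starting symbol for `m` depends on the parity of the number of preceding letters, and this
parity survives expansion because all entries are odd. -/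
theorem expandN_append_of_even {c : ℕ → ℕ} (hc : ∀ k, c k = 1 ∨ c k = 3) (n : ℕ)
    {l : List ℕ} (hl : AllOdd l) (he : Even l.length) (m : List ℕ) :
    expandN c n (l ++ m) = expandN c n l ++ expandN c n m := by
  induction n generalizing l m with
  | zero => rfl
  | succ n ih =>
    simp only [expandN]
    rw [expand_append, ih (allOdd_expand (hc n) l) ((hl.even_length_expand _).2 he), alt,
      if_pos (by exact_mod_cast he)]

/-- An odd number of letters precedes `m` at every level, so every starting symbol is flipped. -/
theorem expandN_append_of_odd {c : ℕ → ℕ} (hc : ∀ k, c k = 1 ∨ c k = 3) (n : ℕ)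
    {l : List ℕ} (hl : AllOdd l) (he : ¬ Even l.length) (m : List ℕ) :
    expandN c n (l ++ m) = expandN c n l ++ expandN (swapOneThree c) n m := by
  induction n generalizing l m with
  | zero => rfl
  | succ n ih =>
    simp only [expandN]
    rw [expand_append, ih (allOdd_expand (hc n) l) (mt (hl.even_length_expand _).1 he), alt,
      if_neg (by exact_mod_cast he)]
    rfl

/-! ### The contraction argument -/

/-- Lengths `L n i` and almost additive counts `F n i` of three words (indexed by `i`) whose
expansions of level `n + 1` are concatenations of expansions of level `n`. -/
structure PairSystem (C : ℝ) (L F : ℕ → Fin 3 → ℝ) : Prop where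
  const_nonneg : 0 ≤ C
  count_nonneg : ∀ n i, 0 ≤ F n i
  length_zero : ∀ i, L 0 i = 2
  length_fst : ∀ n, L (n + 1) 0 = L n 0 + L n 1 + L n 2
  length_trd : ∀ n, L (n + 1) 2 = L n 1
  count_fst_ge : ∀ n, F n 0 + F n 1 + F n 2 ≤ F (n + 1) 0
  count_fst_le : ∀ n, F (n + 1) 0 ≤ F n 0 + F n 1 + F n 2 + 2 * C
  count_trd : ∀ n, F (n + 1) 2 = F n 1
  snd : ∀ n, ∃ j, L (n + 1) 1 = L n 1 + L n j ∧ F n 1 + F n j ≤ F (n + 1) 1 ∧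
    F (n + 1) 1 ≤ F n 1 + F n j + C

namespace PairSystem

variable {C : ℝ} {L F : ℕ → Fin 3 → ℝ} (h : PairSystem C L F)
include h

theorem two_le (n : ℕ) (i : Fin 3) : 2 ≤ L n i := by
  induction n generalizing i with
  | zero => exact (h.length_zero i).ge
  | succ n ih =>
    obtain ⟨j, hj, -⟩ := h.snd n
    have h0 := ih 0
    have h1 := ih 1
    have h2 := ih 2
    have h3 := ih j
    fin_cases i
    · have := h.length_fst n; simp only [Fin.zero_eta]; linarith
    · simp only [Fin.mk_one]; linarith
    · have := h.length_trd n; simp only [Fin.reduceFinMk]; linarith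

/-- The second inequality is chosen to be inductive: the case `j = 2` reproduces it exactly.
Together they bound every length at level `n + 1` by `5 * L n 1`, the source of the share `1 / 5`.
-/
theorem le_snd (n : ℕ) : L n 2 ≤ L n 1 ∧ L n 0 ≤ 2 * L n 1 + L n 2 := by
  induction n with
  | zero => simp only [h.length_zero]; norm_num
  | succ n ih =>
    obtain ⟨j, hj, -⟩ := h.snd n
    have h3 := h.two_le n j
    have h4 := h.two_le n 0
    have h5 := h.two_le n 1
    have h0 := h.length_fst n
    have h2 := h.length_trd n
    refine ⟨by linarith, ?_⟩
    fin_cases j <;> simp only [Fin.zero_eta, Fin.mk_one, Fin.reduceFinMk] at hj <;> linarith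

theorem growth_snd (n : ℕ) : 2 * n + 2 ≤ L n 1 := by
  induction n with
  | zero => simp [h.length_zero]
  | succ n ih =>
    obtain ⟨j, hj, -⟩ := h.snd n
    have := h.two_le n j
    push_cast; linarith

theorem growth (n : ℕ) (i : Fin 3) : n ≤ L n i := by
  cases n with
  | zero => have := h.two_le 0 i; push_cast; linarith
  | succ n =>
    have h1 := h.growth_snd n
    have h3 := h.growth_snd (n + 1)
    have h4 := h.two_le n 0
    have h5 := h.two_le n 2
    have hn : (0 : ℝ) ≤ n := Nat.cast_nonneg n
    have h0 := h.length_fst n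
    have h2 := h.length_trd n
    push_cast at h3 ⊢
    fin_cases i <;> simp only [Fin.zero_eta, Fin.mk_one, Fin.reduceFinMk] <;> linarith

/-- One step of the contraction: bounds for all the ratios at a level yield better ones at the
next level, because the second word has a share of at least `1 / 5` in all three expansions. -/
theorem step_lower {n : ℕ} {V : ℝ} (hV : ∀ i, V * L n i ≤ F n i) (i : Fin 3) :
    (V + (F n 1 / L n 1 - V) / 5) * L (n + 1) i ≤ F (n + 1) i := by
  have hpos : 0 < L n 1 := by linarith [h.two_le n 1]
  have hd : 0 ≤ F n 1 / L n 1 - V := by rw [sub_nonneg, le_div_iff₀ hpos]; exact hV 1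
  have hmul : L n 1 * (F n 1 / L n 1 - V) = F n 1 - V * L n 1 := by field_simp
  -- The other constituents are estimated by `V`, the second word by its actual count; its surplus
  -- over `V` is then spread over a length of at most `5 * L n 1`.
  have key : ∀ M, M ≤ 5 * L n 1 →
      (V + (F n 1 / L n 1 - V) / 5) * M ≤ V * (M - L n 1) + F n 1 := by
    intro M hM
    have := mul_le_mul_of_nonneg_right hM hd
    linarith
  obtain ⟨b1, b2⟩ := h.le_snd n
  obtain ⟨j, hj, hj1, -⟩ := h.snd n
  have hp := h.two_le n
  have h0 := h.length_fst n
  have h2 := h.length_trd n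
  have hLj : L n j ≤ 4 * L n 1 := by
    have := hp 2
    fin_cases j <;> simp only [Fin.zero_eta, Fin.mk_one, Fin.reduceFinMk] <;> linarith
  fin_cases i <;> simp only [Fin.zero_eta, Fin.mk_one, Fin.reduceFinMk]
  · have := key (L (n + 1) 0) (by linarith)
    rw [h0] at this ⊢
    linarith [hV 0, hV 2, h.count_fst_ge n]
  · have := key (L (n + 1) 1) (by linarith)
    rw [hj] at this ⊢
    linarith [hV j]
  · have := key (L (n + 1) 2) (by linarith)
    rw [h2] at this ⊢
    linarith [h.count_trd n]

/-- Dual to `step_lower`, with `F + C` in place of `F`: adding `C` absorbs the occurrences across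
junctions and makes the counts subadditive. -/
theorem step_upper {n : ℕ} {U : ℝ} (hU : ∀ i, F n i + C ≤ U * L n i) (i : Fin 3) :
    F (n + 1) i + C ≤ (U - (U - (F n 1 + C) / L n 1) / 5) * L (n + 1) i := by
  have hpos : 0 < L n 1 := by linarith [h.two_le n 1]
  have hd : 0 ≤ U - (F n 1 + C) / L n 1 := by rw [sub_nonneg, div_le_iff₀ hpos]; exact hU 1
  have hmul : L n 1 * (U - (F n 1 + C) / L n 1) = U * L n 1 - (F n 1 + C) := by field_simp
  have key : ∀ M, M ≤ 5 * L n 1 →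
      U * (M - L n 1) + (F n 1 + C) ≤ (U - (U - (F n 1 + C) / L n 1) / 5) * M := by
    intro M hM
    have := mul_le_mul_of_nonneg_right hM hd
    linarith
  obtain ⟨b1, b2⟩ := h.le_snd n
  obtain ⟨j, hj, -, hj1⟩ := h.snd n
  have hp := h.two_le n
  have h0 := h.length_fst n
  have h2 := h.length_trd n
  have hLj : L n j ≤ 4 * L n 1 := by
    have := hp 2
    fin_cases j <;> simp only [Fin.zero_eta, Fin.mk_one, Fin.reduceFinMk] <;> linarith
  fin_cases i <;> simp only [Fin.zero_eta, Fin.mk_one, Fin.reduceFinMk]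
  · have := key (L (n + 1) 0) (by linarith)
    rw [h0] at this ⊢
    linarith [hU 0, hU 2, h.count_fst_le n]
  · have := key (L (n + 1) 1) (by linarith)
    rw [hj] at this ⊢
    linarith [hU j]
  · have := key (L (n + 1) 2) (by linarith)
    rw [h2] at this ⊢
    linarith [h.count_trd n]

/-- The ratios `F n i / L n i` converge to a common limit. -/
theorem exists_limit : ∃ (V U : ℕ → ℝ) (f : ℝ),
    (∀ n i, V n * L n i ≤ F n i) ∧ (∀ n i, F n i + C ≤ U n * L n i) ∧
      Tendsto V atTop (𝓝 f) ∧ Tendsto U atTop (𝓝 f) := by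
  let V : ℕ → ℝ := fun n => Nat.rec 0 (fun n v => v + (F n 1 / L n 1 - v) / 5) n
  let U : ℕ → ℝ := fun n => Nat.rec (F 0 0 + F 0 1 + F 0 2 + C)
    (fun n u => u - (u - (F n 1 + C) / L n 1) / 5) n
  have hV : ∀ n i, V n * L n i ≤ F n i := by
    intro n
    induction n with
    | zero => intro i; simpa [V] using h.count_nonneg 0 i
    | succ n ih => exact h.step_lower ih
  have hU : ∀ n i, F n i + C ≤ U n * L n i := by
    intro n
    induction n with
    | zero =>
      intro i
      have h0 := h.count_nonneg 0 0
      have h1 := h.count_nonneg 0 1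
      have h2 := h.count_nonneg 0 2
      have hC := h.const_nonneg
      have hU0 : U 0 = F 0 0 + F 0 1 + F 0 2 + C := rfl
      rw [h.length_zero, hU0]
      fin_cases i <;> simp only [Fin.zero_eta, Fin.mk_one, Fin.reduceFinMk] <;> linarith
    | succ n ih => exact h.step_upper ih
  have hpos : ∀ n, 0 < L n 1 := fun n => by linarith [h.two_le n 1]
  have hV1 : ∀ n, V n ≤ F n 1 / L n 1 := fun n => by rw [le_div_iff₀ (hpos n)]; exact hV n 1
  have hU1 : ∀ n, (F n 1 + C) / L n 1 ≤ U n := fun n => by rw [div_le_iff₀ (hpos n)]; exact hU n 1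
  have hFC : ∀ n, (F n 1 + C) / L n 1 = F n 1 / L n 1 + C / L n 1 := fun n => add_div _ _ _
  have hCL : ∀ n, 0 ≤ C / L n 1 := fun n => div_nonneg h.const_nonneg (hpos n).le
  have hVs : ∀ n, V (n + 1) = V n + (F n 1 / L n 1 - V n) / 5 := fun n => rfl
  have hUs : ∀ n, U (n + 1) = U n - (U n - (F n 1 + C) / L n 1) / 5 := fun n => rfl
  have hVmono : Monotone V := monotone_nat_of_le_succ fun n => by
    rw [hVs]; linarith [hV1 n]
  have hUanti : Antitone U := antitone_nat_of_succ_le fun n => by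
    rw [hUs]; linarith [hU1 n]
  have hVU : ∀ n, V n ≤ U n := fun n => by linarith [hV1 n, hU1 n, hFC n, hCL n]
  obtain ⟨f, hf⟩ : ∃ f, Tendsto V atTop (𝓝 f) :=
    ⟨_, tendsto_atTop_ciSup hVmono
      ⟨U 0, by rintro _ ⟨n, rfl⟩; exact (hVU n).trans (hUanti (Nat.zero_le n))⟩⟩
  obtain ⟨g, hg⟩ : ∃ g, Tendsto U atTop (𝓝 g) :=
    ⟨_, tendsto_atTop_ciInf hUanti
      ⟨V 0, by rintro _ ⟨n, rfl⟩; exact (hVmono (Nat.zero_le n)).trans (hVU n)⟩⟩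
  have hL : Tendsto (fun n => L n 1) atTop atTop :=
    tendsto_atTop_mono (fun n => h.growth n 1) tendsto_natCast_atTop_atTop
  have hC0 : Tendsto (fun n => C / L n 1) atTop (𝓝 0) := hL.const_div_atTop C
  -- The gap `U - V` is multiplied by `4/5` at each step, up to an error `C / (5 * L n 1)` tending
  -- to `0`; its limit is therefore `0`.
  have hlim : Tendsto (fun n => U (n + 1) - V (n + 1)) atTop
      (𝓝 (4 / 5 * (g - f) + 1 / 5 * 0)) := by
    have : (fun n => U (n + 1) - V (n + 1)) =
        fun n => 4 / 5 * (U n - V n) + 1 / 5 * (C / L n 1) := by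
      funext n; rw [hVs, hUs, hFC]; ring
    rw [this]
    exact ((hg.sub hf).const_mul _).add (hC0.const_mul _)
  have hlim' := ((tendsto_add_atTop_iff_nat 1).2 hg).sub ((tendsto_add_atTop_iff_nat 1).2 hf)
  have := tendsto_nhds_unique hlim hlim'
  obtain rfl : g = f := by linarith
  exact ⟨V, U, g, hV, hU, hf, hg⟩

end PairSystem

/-! ### Expansions of pairs -/

/-- The pairs of symbols which occur at even positions of an aligned sequence starting with `s`. -/
def pairWord (s : ℕ) : Fin 3 → List ℕ := ![[3, 3], [s, flip s], [1, 1]]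

theorem allOdd_pairWord {s : ℕ} (hs : s = 1 ∨ s = 3) (i : Fin 3) : AllOdd (pairWord s i) := by
  intro v hv
  fin_cases i <;> rcases hs with rfl | rfl <;> simp [pairWord] at hv <;>
    rcases hv with rfl | rfl <;> decide

theorem even_length_pairWord (s : ℕ) (i : Fin 3) : Even (pairWord s i).length := by
  fin_cases i <;> simp [pairWord]

/-- The expansion of level `n` of a pair of symbols of level `n`. -/
def pairExp (c : ℕ → ℕ) (n : ℕ) (i : Fin 3) : List ℕ := expandN c n (pairWord (c n) i)

section

variable {c : ℕ → ℕ} (hc : ∀ k, c k = 1 ∨ c k = 3)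
include hc

theorem expandN_pairWord_append (n : ℕ) (i : Fin 3) (m : List ℕ) :
    expandN c n (pairWord (c n) i ++ m) = pairExp c n i ++ expandN c n m :=
  expandN_append_of_even hc n (allOdd_pairWord (hc n) i) (even_length_pairWord _ i) m

/-- With `s = c n` and `t = flip s`, the pair `33` expands to `sss ttt`, which is cut as `ss`, `st`,
`tt`. -/
theorem pairExp_succ_fst (n : ℕ) :
    pairExp c (n + 1) 0 = pairExp c n 0 ++ (pairExp c n 1 ++ pairExp c n 2) ∨
      pairExp c (n + 1) 0 = pairExp c n 2 ++ (pairExp c n 1 ++ pairExp c n 0) := by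
  have h : ∀ i j k, expand (c n) [3, 3] =
      pairWord (c n) i ++ (pairWord (c n) j ++ pairWord (c n) k) →
      pairExp c (n + 1) 0 = pairExp c n i ++ (pairExp c n j ++ pairExp c n k) := by
    intro i j k hijk
    have hk : pairExp c n k = expandN c n (pairWord (c n) k) := rfl
    rw [hk, ← expandN_pairWord_append hc, ← expandN_pairWord_append hc, ← hijk]
    rfl
  rcases hc n with e | e
  · exact Or.inr (h _ _ _ (by rw [e]; rfl))
  · exact Or.inl (h _ _ _ (by rw [e]; rfl))

/-- With `s = c n` and `t = flip s`, the pair `13` expands to `st tt` and `31` to `ss st`. -/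
theorem pairExp_succ_snd (n : ℕ) : ∃ j,
    pairExp c (n + 1) 1 = pairExp c n 1 ++ pairExp c n j ∨
      pairExp c (n + 1) 1 = pairExp c n j ++ pairExp c n 1 := by
  have h : ∀ i j, expand (c n) [c (n + 1), flip (c (n + 1))] =
      pairWord (c n) i ++ pairWord (c n) j →
      pairExp c (n + 1) 1 = pairExp c n i ++ pairExp c n j := by
    intro i j hij
    have hj : pairExp c n j = expandN c n (pairWord (c n) j) := rfl
    rw [hj, ← expandN_pairWord_append hc, ← hij]
    rfl
  rcases hc n with e | e <;> rcases hc (n + 1) with e' | e'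
  · exact ⟨0, Or.inl (h _ _ (by rw [e, e']; rfl))⟩
  · exact ⟨2, Or.inr (h _ _ (by rw [e, e']; rfl))⟩
  · exact ⟨2, Or.inl (h _ _ (by rw [e, e']; rfl))⟩
  · exact ⟨0, Or.inr (h _ _ (by rw [e, e']; rfl))⟩

theorem pairSystem (w : List ℕ) :
    PairSystem w.length (fun n i => (pairExp c n i).length)
      (fun n i => occList w (pairExp c n i)) where
  const_nonneg := Nat.cast_nonneg _
  count_nonneg _ _ := Nat.cast_nonneg _
  length_zero i := by fin_cases i <;> rfl
  length_fst n := by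
    rcases pairExp_succ_fst hc n with h | h <;> rw [h] <;> simp only [List.length_append] <;>
      push_cast <;> ring
  -- The pair `11` expands to the mixed pair one level down.
  length_trd n := rfl
  count_fst_ge n := by
    rcases pairExp_succ_fst hc n with h | h <;> rw [h]
    · have h1 := occList_add_le_append w (pairExp c n 0) (pairExp c n 1 ++ pairExp c n 2)
      have h2 := occList_add_le_append w (pairExp c n 1) (pairExp c n 2)
      norm_cast; omega
    · have h1 := occList_add_le_append w (pairExp c n 2) (pairExp c n 1 ++ pairExp c n 0)
      have h2 := occList_add_le_append w (pairExp c n 1) (pairExp c n 0)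
      norm_cast; omega
  count_fst_le n := by
    rcases pairExp_succ_fst hc n with h | h <;> rw [h]
    · have h1 := occList_append_le w (pairExp c n 0) (pairExp c n 1 ++ pairExp c n 2)
      have h2 := occList_append_le w (pairExp c n 1) (pairExp c n 2)
      norm_cast; omega
    · have h1 := occList_append_le w (pairExp c n 2) (pairExp c n 1 ++ pairExp c n 0)
      have h2 := occList_append_le w (pairExp c n 1) (pairExp c n 0)
      norm_cast; omega
  count_trd n := rfl
  snd n := by
    obtain ⟨j, h | h⟩ := pairExp_succ_snd hc n
    · have h1 := occList_add_le_append w (pairExp c n 1) (pairExp c n j)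
      have h2 := occList_append_le w (pairExp c n 1) (pairExp c n j)
      refine ⟨j, ?_⟩
      rw [h, List.length_append]
      norm_cast
    · have h1 := occList_add_le_append w (pairExp c n j) (pairExp c n 1)
      have h2 := occList_append_le w (pairExp c n j) (pairExp c n 1)
      refine ⟨j, ?_⟩
      rw [h, List.length_append]
      norm_cast
      omega

theorem le_length_pairExp (n : ℕ) (i : Fin 3) : n ≤ (pairExp c n i).length := by
  exact_mod_cast (pairSystem hc []).growth n i

theorem length_pairExp_pos (n : ℕ) (i : Fin 3) : 0 < (pairExp c n i).length := by
  have := (pairSystem hc []).two_le n i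
  have : 2 ≤ (pairExp c n i).length := by exact_mod_cast this
  omega

end

/-! ### Existence of frequencies -/

theorem pre_two_mul_succ (x : ℤ → ℕ) (q : ℕ) :
    pre x (2 * (q + 1)) = pre x (2 * q) ++ [x (2 * q), x (2 * q + 1)] := by
  rw [show 2 * (q + 1) = 2 * q + 1 + 1 by ring, pre_succ, pre_succ, List.append_assoc]
  push_cast; rfl

/-- A symbol change inside the pair is a block start at an odd position, hence begins a block of odd
index, whose symbol is `flip (x 0)`. -/
theorem Nice.exists_pairWord {x : ℤ → ℕ} (h : Nice x) (q : ℤ) :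
    ∃ i, [x (2 * q), x (2 * q + 1)] = pairWord (x 0) i := by
  by_cases he : x (2 * q) = x (2 * q + 1)
  · rcases h.oneThree (2 * q + 1) with e | e
    · exact ⟨2, by rw [he, e]; rfl⟩
    · exact ⟨0, by rw [he, e]; rfl⟩
  · have hs : IsBlockStart x (2 * q + 1) := by
      unfold IsBlockStart
      rwa [show 2 * q + 1 - 1 = 2 * q by ring]
    obtain ⟨j, hj⟩ := h.isEnum.exists_eq hs
    have h1 := h.apply_blockStart j
    have h2 := h.even_blockStart_iff j
    rw [← hj] at h1 h2
    rw [alt, if_neg (by rw [← h2]; simp [parity_simps])] at h1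
    have h3 : x (2 * q) = x 0 := by
      have := eq_flip_of_ne (h.oneThree _) (h.oneThree _) (Ne.symm he)
      rw [this, h1, flip_flip]
    exact ⟨1, by rw [h3, h1]; rfl⟩

theorem Nice.allOdd_pre {x : ℤ → ℕ} (h : Nice x) (n : ℕ) : AllOdd (pre x n) := by
  intro v hv
  simp only [pre, List.mem_map] at hv
  obtain ⟨i, -, rfl⟩ := hv
  rcases h.oneThree i with e | e <;> rw [e] <;> decide

section

variable {x : ℤ → ℕ} (hx : x ∈ infAlignedSet)
include hx

theorem exists_expandN_pre_succ (n q : ℕ) : ∃ i,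
    expandN (column x) n (pre (iterDeriv n x) (2 * (q + 1))) =
      expandN (column x) n (pre (iterDeriv n x) (2 * q)) ++ pairExp (column x) n i := by
  have h := mem_infAlignedSet_iff.1 hx n
  obtain ⟨i, hi⟩ := h.exists_pairWord q
  refine ⟨i, ?_⟩
  rw [pre_two_mul_succ, expandN_append_of_even (column_oneThree hx) n (h.allOdd_pre _) (by simp),
    hi]
  rfl

/-- The prefix of length `N` of an infinitely well-aligned sequence, compared with the expansions
of level `n`. -/
theorem occ_bounds (w : List ℕ) (n : ℕ) {V U : ℝ}
    (hV : ∀ i, V * (pairExp (column x) n i).length ≤ occList w (pairExp (column x) n i))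
    (hU : ∀ i, occList w (pairExp (column x) n i) + (w.length : ℝ) ≤
      U * (pairExp (column x) n i).length) :
    ∃ K : ℝ, ∀ N : ℕ, V * N - K ≤ occ x w N ∧ (occ x w N : ℝ) ≤ U * N + K := by
  have hc := column_oneThree hx
  set c := column x with hcdef
  set P : ℕ → List ℕ := fun q => expandN c n (pre (iterDeriv n x) (2 * q)) with hP
  have hsucc : ∀ q, ∃ i, P (q + 1) = P q ++ pairExp c n i := exists_expandN_pre_succ hx n
  have hP0 : P 0 = [] := by
    have : ∀ n, expandN c n [] = [] := by
      intro n
      induction n with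
      | zero => rfl
      | succ n ih => simpa [expandN, expand] using ih
    simp [hP, pre, this]
  have hpre : ∀ q, pre x (P q).length = P q := fun q => pre_eq_expandN hx n (2 * q)
  have hbd : ∀ q, V * (P q).length ≤ occList w (P q) ∧ (occList w (P q) : ℝ) ≤ U * (P q).length := by
    intro q
    induction q with
    | zero => simp [hP0, occList]
    | succ q ih =>
      obtain ⟨i, hi⟩ := hsucc q
      have h1 := occList_add_le_append w (P q) (pairExp c n i)
      have h2 := occList_append_le w (P q) (pairExp c n i)
      rw [hi, List.length_append]
      rify at h1 h2
      push_cast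
      have := hV i
      have := hU i
      constructor <;> linarith
  have hfind : ∀ N : ℕ, ∃ q, (P q).length ≤ N ∧ N < (P (q + 1)).length := by
    intro N
    induction N with
    | zero =>
      refine ⟨0, by simp [hP0], ?_⟩
      obtain ⟨i, hi⟩ := hsucc 0
      have := length_pairExp_pos hc n i
      rw [hi, List.length_append]; omega
    | succ N ih =>
      obtain ⟨q, h1, h2⟩ := ih
      by_cases h3 : N + 1 < (P (q + 1)).length
      · exact ⟨q, by omega, h3⟩
      · refine ⟨q + 1, by omega, ?_⟩
        obtain ⟨i, hi⟩ := hsucc (q + 1)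
        have := length_pairExp_pos hc n i
        rw [hi, List.length_append]; omega
  -- `M` bounds the distance from `N` to the neighbouring cut points, so the error is independent of
  -- `N`.
  set M : ℕ := (pairExp c n 0).length + (pairExp c n 1).length + (pairExp c n 2).length with hM
  have hMi : ∀ i, (pairExp c n i).length ≤ M := by
    intro i; fin_cases i <;> simp only [Fin.zero_eta, Fin.mk_one, Fin.reduceFinMk] <;> omega
  have mono : ∀ {u v : List ℕ}, u <+: v → occList w u ≤ occList w v := by
    rintro u _ ⟨t, rfl⟩
    have := occList_add_le_append w u t
    omega
  refine ⟨(|V| + |U|) * M, fun N => ?_⟩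
  obtain ⟨q, h1, h2⟩ := hfind N
  obtain ⟨i, hi⟩ := hsucc q
  have hlen : (P (q + 1)).length ≤ (P q).length + M := by
    rw [hi, List.length_append]; have := hMi i; omega
  have o1 : occList w (P q) ≤ occ x w N := by
    rw [occ_eq_occList, ← hpre q]; exact mono (pre_prefix h1)
  have o2 : occ x w N ≤ occList w (P (q + 1)) := by
    rw [occ_eq_occList, ← hpre (q + 1)]; exact mono (pre_prefix h2.le)
  have b1 := (hbd q).1
  have b2 := (hbd (q + 1)).2
  rify at o1 o2 h1 h2 hlen
  have e1 : V * N - V * (P q).length ≤ |V| * M := by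
    rw [← mul_sub]
    exact (le_abs_self _).trans (by
      rw [abs_mul]
      exact mul_le_mul_of_nonneg_left (by rw [abs_of_nonneg] <;> linarith) (abs_nonneg _))
  have e2 : U * (P (q + 1)).length - U * N ≤ |U| * M := by
    rw [← mul_sub]
    exact (le_abs_self _).trans (by
      rw [abs_mul]
      exact mul_le_mul_of_nonneg_left (by rw [abs_of_nonneg] <;> linarith) (abs_nonneg _))
  have e3 : 0 ≤ |V| * M := by positivity
  have e4 : 0 ≤ |U| * M := by positivity
  constructor <;> linarith

/-- The second limit expresses the frequency through the column alone, which allows two sequences to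
be compared. -/
theorem exists_hasFreq (w : List ℕ) : ∃ f, HasFreq x w f ∧
    Tendsto (fun n => (occList w (pairExp (column x) n 1) : ℝ) / (pairExp (column x) n 1).length)
      atTop (𝓝 f) := by
  have hc := column_oneThree hx
  obtain ⟨V, U, f, hV, hU, hVf, hUf⟩ := (pairSystem hc w).exists_limit
  have hlim : ∀ A K : ℝ, Tendsto (fun N : ℕ => A + K / (N : ℝ)) atTop (𝓝 A) := by
    intro A K
    simpa using tendsto_const_nhds.add (tendsto_const_div_atTop_nhds_zero_nat K)
  refine ⟨f, ?_, ?_⟩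
  · refine tendsto_order.2 ⟨fun a ha => ?_, fun a ha => ?_⟩
    · obtain ⟨n, hn⟩ := (hVf.eventually_const_lt ha).exists
      obtain ⟨K, hK⟩ := occ_bounds hx w n (hV n) (hU n)
      filter_upwards [(hlim (V n) (-K)).eventually_const_lt hn, eventually_gt_atTop 0] with N h1 h2
      have hN : (0 : ℝ) < N := by exact_mod_cast h2
      refine h1.trans_le ?_
      rw [le_div_iff₀ hN, add_mul, div_mul_cancel₀ _ hN.ne']
      linarith [(hK N).1]
    · obtain ⟨n, hn⟩ := (hUf.eventually_lt_const ha).exists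
      obtain ⟨K, hK⟩ := occ_bounds hx w n (hV n) (hU n)
      filter_upwards [(hlim (U n) K).eventually_lt_const hn, eventually_gt_atTop 0] with N h1 h2
      have hN : (0 : ℝ) < N := by exact_mod_cast h2
      refine lt_of_le_of_lt ?_ h1
      rw [div_le_iff₀ hN, add_mul, div_mul_cancel₀ _ hN.ne']
      exact (hK N).2
  · have hpos : ∀ n, (0 : ℝ) < (pairExp (column x) n 1).length := fun n => by
      exact_mod_cast length_pairExp_pos hc n 1
    refine tendsto_of_tendsto_of_tendsto_of_le_of_le hVf hUf (fun n => ?_) (fun n => ?_)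
    · simp only
      rw [le_div_iff₀ (hpos n)]; exact hV n 1
    · simp only
      rw [div_le_iff₀ (hpos n)]
      have := hU n 1
      have : (0 : ℝ) ≤ w.length := Nat.cast_nonneg _
      linarith

end

/-! ### Swapped columns and equality of frequencies -/

theorem swapOneThree_swapOneThree (c : ℕ → ℕ) : swapOneThree (swapOneThree c) = c := by
  funext k; exact flip_flip _

/-- The expansions of the mixed pair for two swapped columns consist of the same two words in the
two possible orders. -/
theorem exists_pairExp_swap {c : ℕ → ℕ} (hc : ∀ k, c k = 1 ∨ c k = 3) (n : ℕ) : ∃ u v,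
    pairExp c n 1 = u ++ v ∧ pairExp (swapOneThree c) n 1 = v ++ u := by
  have hodd : ∀ s, (s = 1 ∨ s = 3) → AllOdd [s] := by
    rintro s (rfl | rfl) v hv <;> simp only [List.mem_singleton] at hv <;> subst hv <;> decide
  have hc' : ∀ k, swapOneThree c k = 1 ∨ swapOneThree c k = 3 := fun k => flip_mem (hc k)
  refine ⟨expandN c n [c n], expandN (swapOneThree c) n [flip (c n)], ?_, ?_⟩
  · exact expandN_append_of_odd hc n (hodd _ (hc n)) (by simp) [flip (c n)]
  · have := expandN_append_of_odd hc' n (hodd _ (hc' n)) (by simp) [flip (swapOneThree c n)]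
    rw [swapOneThree_swapOneThree] at this
    have e : flip (swapOneThree c n) = c n := flip_flip _
    rw [e] at this
    rw [pairExp]
    change expandN _ n [swapOneThree c n, flip (swapOneThree c n)] = _
    rw [e]
    exact this

/-- The two mixed expansions are rotations of each other: equal lengths tending to infinity, counts
differing by at most `w.length`. -/
theorem hasFreq_of_column_swap {x y : ℤ → ℕ} (hx : x ∈ infAlignedSet) (hy : y ∈ infAlignedSet)
    (hxy : column y = swapOneThree (column x)) (w : List ℕ) :
    ∃ f, HasFreq x w f ∧ HasFreq y w f := by
  have hc := column_oneThree hx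
  obtain ⟨f, hf, hf'⟩ := exists_hasFreq hx w
  obtain ⟨g, hg, hg'⟩ := exists_hasFreq hy w
  rw [hxy] at hg'
  refine ⟨f, hf, ?_⟩
  suffices g = f by rwa [← this]
  have hL : Tendsto (fun n => ((pairExp (column x) n 1).length : ℝ)) atTop atTop :=
    tendsto_atTop_mono (fun n => by exact_mod_cast le_length_pairExp hc n 1)
      tendsto_natCast_atTop_atTop
  have hW := hL.const_div_atTop (w.length : ℝ)
  have hsub := hg'.sub hf'
  have h0 : Tendsto (fun n =>
      (occList w (pairExp (swapOneThree (column x)) n 1) : ℝ) /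
        (pairExp (swapOneThree (column x)) n 1).length -
      (occList w (pairExp (column x) n 1) : ℝ) / (pairExp (column x) n 1).length)
      atTop (𝓝 0) := by
    refine squeeze_zero_norm (fun n => ?_) hW
    obtain ⟨u, v, h1, h2⟩ := exists_pairExp_swap hc n
    have a1 := occList_append_comm_le w u v
    have a2 := occList_append_comm_le w v u
    rify at a1 a2
    rw [h1, h2, List.length_append, List.length_append, Nat.add_comm v.length, ← sub_div,
      Real.norm_eq_abs, abs_div, abs_of_nonneg (a := ((u.length + v.length : ℕ) : ℝ))
        (Nat.cast_nonneg _)]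
    gcongr
    rw [abs_le]
    constructor <;> linarith
  have := tendsto_nhds_unique hsub h0
  linarith

/-! ### Injectivity of the column map -/

theorem eq_on_nonneg_of_column_eq {x y : ℤ → ℕ} (hx : x ∈ infAlignedSet)
    (hy : y ∈ infAlignedSet) (hxy : column x = column y) (p : ℕ) : x p = y p := by
  have hc := column_oneThree hx
  -- The next column entry is the length of the block at `0`, so it tells whether the second letter
  -- repeats the first.
  have hpair : ∀ {z : ℤ → ℕ}, z ∈ infAlignedSet → ∀ n, pre (iterDeriv n z) 2 =
      [column z n, if column z (n + 1) = 1 then flip (column z n) else column z n] := by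
    intro z hz n
    have h := mem_infAlignedSet_iff.1 hz n
    have h0 := h.blockStart_zero
    have hs := h.blockStart_succ 0
    rw [h0] at hs
    have e : pre (iterDeriv n z) 2 = [iterDeriv n z 0, iterDeriv n z 1] := rfl
    rw [e]
    simp only [column, iterDeriv_succ]
    congr 2
    rcases h.deriv_oneThree 0 with e | e <;> rw [e] at hs ⊢
    · rw [if_pos rfl, h.apply_eq_alt (j := 1) (by simpa using hs.le)
        (by have := h.isEnum.lt 1; have : blockStart (iterDeriv n z) 1 = 1 := by simpa using hs
            omega)]
      rfl
    · rw [if_neg (by decide), h.apply_eq_alt (j := 0) (by rw [h0]; decide) (by rw [hs]; decide)]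
      rfl
  have hpre : pre (iterDeriv (p + 1) x) 2 = pre (iterDeriv (p + 1) y) 2 := by
    rw [hpair hx, hpair hy, hxy]
  have h1 := pre_eq_expandN hx (p + 1) 2
  have h2 := pre_eq_expandN hy (p + 1) 2
  rw [hpre, hxy, ← h2] at h1
  obtain ⟨i, hi⟩ := (mem_infAlignedSet_iff.1 hx (p + 1)).exists_pairWord 0
  have hlen : p < (expandN (column y) (p + 1) (pre (iterDeriv (p + 1) y) 2)).length := by
    have e : pre (iterDeriv (p + 1) x) 2 = pairWord (column x (p + 1)) i := hi
    rw [← hpre, ← hxy, e]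
    exact le_length_pairExp hc (p + 1) i
  rw [length_pre] at h1
  simp only [pre, List.map_inj_left, List.mem_range] at h1
  exact h1 p hlen

theorem eq_of_column_eq {x y : ℤ → ℕ} (hx : x ∈ infAlignedSet) (hy : y ∈ infAlignedSet)
    (hxy : column x = column y) : x = y := by
  funext n
  rcases le_or_gt 0 n with hn | hn
  · have := eq_on_nonneg_of_column_eq hx hy hxy n.toNat
    rwa [Int.toNat_of_nonneg hn] at this
  · have := eq_on_nonneg_of_column_eq (mirror_mem_infAlignedSet hx) (mirror_mem_infAlignedSet hy)
      (by rw [column_mirror hx, column_mirror hy, hxy]) (-1 - n).toNat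
    rw [Int.toNat_of_nonneg (by omega)] at this
    simpa [mirror] using this

end SmoothSeq

theorem mainTheorem5 (x : ℤ → ℕ) (hx : x ∈ SmoothSeq.infAlignedSet) :
    ∃ x' : ℤ → ℕ,
      -- `x'` is the unique preimage of the swapped column sequence under the column map
      (∀ z : ℤ → ℕ, (z ∈ SmoothSeq.infAlignedSet ∧
        SmoothSeq.column z = SmoothSeq.swapOneThree (SmoothSeq.column x)) ↔ z = x') ∧
      x' ≠ x ∧
      -- both sequences have one and the same type sequence
      (∃ τ : ℕ → Fin 2, (∀ σ : ℕ → Fin 2, SmoothSeq.HasTypes x σ ↔ σ = τ) ∧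
        (∀ σ : ℕ → Fin 2, SmoothSeq.HasTypes x' σ ↔ σ = τ)) ∧
      -- every pattern has a frequency in both sequences, and the two frequencies agree
      (∀ w : List ℕ, (∀ c ∈ w, c = 1 ∨ c = 3) →
        ∃ f : ℝ, SmoothSeq.HasFreq x w f ∧ SmoothSeq.HasFreq x' w f) := by
  have hm := SmoothSeq.mirror_mem_infAlignedSet hx
  have hcol := SmoothSeq.column_mirror hx
  refine ⟨SmoothSeq.mirror x, fun z => ⟨fun hz => ?_, ?_⟩, fun he => ?_, ⟨_,
    SmoothSeq.hasTypes_iff hx, fun σ => ?_⟩,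
    fun w _ => SmoothSeq.hasFreq_of_column_swap hx hm hcol w⟩
  · exact SmoothSeq.eq_of_column_eq hz.1 hm (hz.2.trans hcol.symm)
  · rintro rfl
    exact ⟨hm, hcol⟩
  · rw [he] at hcol
    exact SmoothSeq.flip_ne (SmoothSeq.column_oneThree hx 0) (congrFun hcol 0).symm
  · rw [SmoothSeq.hasTypes_iff hm, hcol]
    -- Swapping is injective, so it preserves whether consecutive column entries agree.
    simp only [SmoothSeq.swapOneThree, (Equiv.swap 1 3).injective.eq_iff]
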